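/- Let $K$ be an algebraically closed field of characteristic $0$, let $R=K[x_0,x_1,x_2]$ be the homogeneous coordinate ring of $\mathbb{P}^2_K$, and let $M=(x_0,x_1,x_2)\subseteq R$. For a point $P\in\mathbb{P}^2_K$ let $I(P)\subseteq R$ be the ideal generated by all homogeneous polynomials vanishing at $P$. Let $n\ge 5$ be odd, let $P_1,\dots,P_n$ be distinct points lying on a smooth conic in $\mathbb{P}^2_K$, let $I=\bigcap_{j=1}^n I(P_j)$ be their radical ideal, and for $m\ge 1$ let $I^{(m)}=\bigcap_{j=1}^n I(P_j)^m$ be its $m$-th symbolic power. Then for all integers $m,t\ge 1$ $$I^{(t(m+1))}\subseteq M^t\,(I^{(m)})^t,\qquad I^{(t(m+1)-1)}\subseteq (I^{(m)})^t,\qquad\text{and}\qquad I^{(t(m+1)-1)}\subseteq M^{t-1}\,(I^{(m)})^t.$$ -/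

import Mathlib

open scoped LinearAlgebra.Projectivization

/-- A polynomial in the `N + 1` coordinates vanishes at a point `P` of `ℙ^N`, tested on a
representative of `P`. For forms this does not depend on the representative. -/
def VanishesAt {K : Type*} [Field K] {N : ℕ}
    (F : MvPolynomial (Fin (N + 1)) K) (P : ℙ K (Fin (N + 1) → K)) : Prop :=
  MvPolynomial.eval P.rep F = 0

/-- `I(P)`: the ideal generated by all forms that vanish at the point `P` of `ℙ^N`. -/
noncomputable def pointIdeal {K : Type*} [Field K] {N : ℕ} (P : ℙ K (Fin (N + 1) → K)) :
    Ideal (MvPolynomial (Fin (N + 1)) K) :=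
  Ideal.span {F | (∃ d : ℕ, F.IsHomogeneous d) ∧ VanishesAt F P}

/-- The `m`-th symbolic power `I^{(m)} = ⋂_{P ∈ S} I(P)^m` of the radical ideal
`I = ⋂_{P ∈ S} I(P)` of a finite set `S` of points of `ℙ^N`. -/
noncomputable def pointsSymbolicPower {K : Type*} [Field K] {N : ℕ} (S : Finset (ℙ K (Fin (N + 1) → K))) (m : ℕ) :
    Ideal (MvPolynomial (Fin (N + 1)) K) :=
  ⨅ P ∈ S, pointIdeal P ^ m

/-- The irrelevant ideal `M = (x_0, …, x_N)`. -/
noncomputable def irrelevantIdeal (K : Type*) [Field K] (N : ℕ) : Ideal (MvPolynomial (Fin (N + 1)) K) :=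
  Ideal.span (Set.range MvPolynomial.X)

/-- `F` is a ternary quadratic form whose zero locus in `ℙ²` is a smooth conic: at every zero
some first partial derivative does not vanish. This forces `F ≠ 0`. -/
def IsSmoothConic {K : Type*} [Field K] (F : MvPolynomial (Fin 3) K) : Prop :=
  F.IsHomogeneous 2 ∧
    ∀ P : ℙ K (Fin 3 → K), VanishesAt F P →
      ∃ i : Fin 3, ¬ VanishesAt (MvPolynomial.pderiv i F) P

/-!
The smooth conic `C = 0` is a rational curve, and restriction to it identifies forms of degree `d`
modulo `C` with polynomials in one variable of degree at most `2 d`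
(`nonempty_conicParam`, `ConicParam.exists_eq_mul_of_toPoly_eq_zero`). Let `n` be the number of
points, and `h` the polynomial of degree `n` whose roots are their parameters. A form in `I^{(a)}`
restricts to a multiple of `h ^ a`. Conversely, if `n a ≤ 2 d`, every multiple of `h ^ a` of degree
at most `2 d` is the restriction of a form of degree `d` in `I^{(a)}`, namely of a product of lines
joining successive points in a cyclic order (`ConicParam.exists_toPoly_eq`). Since `C` has a simple
zero at every point, a form in `I^{(a+1)}` vanishing on the conic is `C` times a form in `I^{(a)}`.

Factoring polynomials on the conic and inducting on the multiple of `C` that is left over, one gets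
`I^{(a+b)}_{d+e} = I^{(a)}_d I^{(b)}_e` as soon as `n a ≤ 2 d` and `n b ≤ 2 e`
(`symbolicForms_add_le_mul`). On the other hand a form of degree `d` in `I^{(a)}` with `2 d < n a`
is divisible by `C`. So a form in `I^{(tm+q)}` is `C ^ j G`, where either `j = t m` and
`G ∈ I^{(q)} ⊆ M ^ q`, or `j ≤ t m` and `G` is a form of degree `e` in `I^{(tm-j+q)}` with
`n (t m - j + q) ≤ 2 e`. In the second case the copies of `C` are shared out among `t` factors, and
`G` is split accordingly, with a factor of degree `q` to spare, because `n q ≥ t + 2 q` for `n ≥ 5`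
in the cases `q = t`, and `q = t - 1` with `t ≥ 2`.
-/

/-! ### The order of vanishing at a point -/

theorem eval_eq_zero_of_mem_pointIdeal {K : Type*} [Field K] {N : ℕ}
    {P : ℙ K (Fin (N + 1) → K)} {F : MvPolynomial (Fin (N + 1)) K} (hF : F ∈ pointIdeal P) :
    MvPolynomial.eval P.rep F = 0 := by
  have h : pointIdeal P ≤ RingHom.ker (MvPolynomial.eval P.rep) :=
    Ideal.span_le.2 fun G hG => hG.2
  exact h hF

theorem mem_pointIdeal_of_isHomogeneous {K : Type*} [Field K] {N : ℕ}
    {P : ℙ K (Fin (N + 1) → K)} {F : MvPolynomial (Fin (N + 1)) K} {d : ℕ}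
    (hF : F.IsHomogeneous d) (hP : VanishesAt F P) : F ∈ pointIdeal P :=
  Ideal.subset_span ⟨⟨d, hF⟩, hP⟩

/-- The powers of `I(P)` are the sublevel sets of an order function pulled back from the `T`-adic
one on `R[T]`. The homomorphism `R → R[T]` is `x ↦ p + T (x - p)`, where `p` is the multiple of
the representative of `P` on which a fixed linear form takes the same value as on `x`. -/
theorem exists_algHom_mem_pointIdeal_pow_iff {K : Type*} [Field K] {N : ℕ}
    (P : ℙ K (Fin (N + 1) → K)) :
    ∃ φ : MvPolynomial (Fin (N + 1)) K →ₐ[K] Polynomial (MvPolynomial (Fin (N + 1)) K),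
      ∀ (a : ℕ) (F : MvPolynomial (Fin (N + 1)) K),
        F ∈ pointIdeal P ^ a ↔
          (Polynomial.X : Polynomial (MvPolynomial (Fin (N + 1)) K)) ^ a ∣ φ F := by
  obtain ⟨k, hk⟩ : ∃ k, P.rep k ≠ 0 := Function.ne_iff.1 P.rep_nonzero
  set l : MvPolynomial (Fin (N + 1)) K := MvPolynomial.C (P.rep k)⁻¹ * MvPolynomial.X k with hl
  have hl1 : l.IsHomogeneous 1 := MvPolynomial.isHomogeneous_C_mul_X _ _
  have hlP : MvPolynomial.eval P.rep l = 1 := by simp [hl, hk]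
  set y : Fin (N + 1) → MvPolynomial (Fin (N + 1)) K :=
    fun i => MvPolynomial.X i - l * MvPolynomial.C (P.rep i) with hy
  have hyI : ∀ i, y i ∈ pointIdeal P := fun i => by
    refine mem_pointIdeal_of_isHomogeneous (d := 1) ?_ ?_
    · refine (MvPolynomial.isHomogeneous_X _ _).sub ?_
      rw [mul_comm]
      exact hl1.C_mul _
    · simp [VanishesAt, hy, hlP]
  let φ : MvPolynomial (Fin (N + 1)) K →ₐ[K] Polynomial (MvPolynomial (Fin (N + 1)) K) :=
    MvPolynomial.aeval fun i =>
      Polynomial.C (l * MvPolynomial.C (P.rep i)) + Polynomial.X * Polynomial.C (y i)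
  have hφX : ∀ i, φ (MvPolynomial.X i) =
      Polynomial.C (l * MvPolynomial.C (P.rep i)) + Polynomial.X * Polynomial.C (y i) :=
    fun i => MvPolynomial.aeval_X _ _
  -- At `T = 0` a form `F` of degree `d` becomes `l ^ d * F(P)`.
  have hzero : ∀ (F : MvPolynomial (Fin (N + 1)) K) (d : ℕ), F.IsHomogeneous d →
      (φ F).coeff 0 = l ^ d * MvPolynomial.C (MvPolynomial.eval P.rep F) := by
    intro F d hF
    have h1 : (φ F).coeff 0 =
        MvPolynomial.aeval (fun i => l * MvPolynomial.C (P.rep i)) F := by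
      have : (Polynomial.constantCoeff.comp φ.toRingHom) =
          (MvPolynomial.aeval (R := K) (fun i => l * MvPolynomial.C (P.rep i))).toRingHom := by
        refine MvPolynomial.ringHom_ext ?_ ?_
        · intro r
          simp [φ, Polynomial.algebraMap_apply]
        · intro i
          simp [hφX]
      exact congrArg (fun f => f F) this
    rw [h1, F.as_sum, map_sum, map_sum, map_sum, Finset.mul_sum]
    refine Finset.sum_congr rfl fun s hs => ?_
    have hdeg : ∑ i ∈ s.support, s i = d := by
      have := hF.degree_eq_sum_deg_support hs
      rw [← this]
    rw [MvPolynomial.aeval_monomial, MvPolynomial.eval_monomial, Finsupp.prod, Finsupp.prod,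
      map_mul, map_prod, ← hdeg, ← Finset.prod_pow_eq_pow_sum, MvPolynomial.algebraMap_eq,
      mul_left_comm, ← Finset.prod_mul_distrib]
    congr 1
    refine Finset.prod_congr rfl fun i _ => ?_
    rw [mul_pow, map_pow]
  -- `φ` maps into the Rees algebra of `I(P)`: the coefficient of `T ^ k` lies in `I(P) ^ k`.
  have hrees : ∀ F, φ F ∈ reesAlgebra (pointIdeal P) := by
    intro F
    induction F using MvPolynomial.induction_on with
    | C r =>
      have : φ (MvPolynomial.C r) = algebraMap (MvPolynomial (Fin (N + 1)) K) _
          (MvPolynomial.C r) := by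
        simp [φ, Polynomial.algebraMap_apply]
      rw [this]
      exact Subalgebra.algebraMap_mem _ _
    | add p q hp hq => rw [map_add]; exact add_mem hp hq
    | mul_X p i hp =>
      rw [map_mul, hφX]
      refine mul_mem hp (add_mem (Subalgebra.algebraMap_mem _ _) ?_)
      rw [mul_comm, ← pow_one Polynomial.X, Polynomial.C_mul_X_pow_eq_monomial,
        reesAlgebra.monomial_mem, pow_one]
      exact hyI i
  -- At `T = 1` the polynomial `F` is recovered, as the sum of the coefficients of `φ F`.
  have hone : ∀ F, (φ F).eval 1 = F := by
    intro F
    have : (Polynomial.evalRingHom 1).comp φ.toRingHom = RingHom.id _ := by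
      refine MvPolynomial.ringHom_ext ?_ ?_
      · intro r
        simp [φ, Polynomial.algebraMap_apply]
      · intro i
        simp [hφX, hy]
    exact congrArg (fun f => f F) this
  refine ⟨φ, fun a F => ⟨fun hF => ?_, fun hF => ?_⟩⟩
  · have h1 : pointIdeal P ≤ (Ideal.span {Polynomial.X}).comap φ := by
      refine Ideal.span_le.2 ?_
      rintro G ⟨⟨d, hd⟩, hG⟩
      rw [SetLike.mem_coe, Ideal.mem_comap, Ideal.mem_span_singleton, Polynomial.X_dvd_iff,
        hzero G d hd, show MvPolynomial.eval P.rep G = 0 from hG, map_zero, mul_zero]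
    have h2 := (Ideal.pow_right_mono h1 a).trans (Ideal.le_comap_pow φ a) hF
    rwa [Ideal.mem_comap, Ideal.span_singleton_pow, Ideal.mem_span_singleton] at h2
  · rw [← hone F, Polynomial.eval_eq_sum_range]
    refine Ideal.sum_mem _ fun i _ => ?_
    rw [one_pow, mul_one]
    rcases lt_or_ge i a with hi | hi
    · rw [Polynomial.X_pow_dvd_iff.1 hF i hi]
      exact zero_mem _
    · exact Ideal.pow_le_pow_right hi ((mem_reesAlgebra_iff _ _).1 (hrees F) i)

/-- Contrapositively, a polynomial with a nonzero partial derivative at `P` has order at most one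
there; this applies to the equation of a smooth conic. -/
theorem eval_pderiv_eq_zero_of_mem_pointIdeal_sq {K : Type*} [Field K] {N : ℕ}
    {P : ℙ K (Fin (N + 1) → K)} {F : MvPolynomial (Fin (N + 1)) K} (hF : F ∈ pointIdeal P ^ 2)
    (i : Fin (N + 1)) : VanishesAt (MvPolynomial.pderiv i F) P := by
  rw [pow_two] at hF
  unfold VanishesAt
  refine Submodule.mul_induction_on hF (fun a ha b hb => ?_) fun a b ha hb => ?_
  · simp [Derivation.leibniz, eval_eq_zero_of_mem_pointIdeal ha,
      eval_eq_zero_of_mem_pointIdeal hb]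
  · rw [map_add, map_add, ha, hb, add_zero]

/-- Division by a form with a simple zero at `P` lowers the order at `P` by one. -/
theorem mem_pointIdeal_pow_of_mul_mem {K : Type*} [Field K] {N : ℕ}
    {P : ℙ K (Fin (N + 1) → K)} {F G : MvPolynomial (Fin (N + 1)) K} (hF : F ∈ pointIdeal P)
    (hF2 : F ∉ pointIdeal P ^ 2) {a : ℕ} (h : F * G ∈ pointIdeal P ^ (a + 1)) :
    G ∈ pointIdeal P ^ a := by
  obtain ⟨φ, hφ⟩ := exists_algHom_mem_pointIdeal_pow_iff P
  rw [← pow_one (pointIdeal P), hφ, pow_one] at hF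
  rw [hφ] at hF2 h ⊢
  obtain ⟨f, hf⟩ := hF
  rw [map_mul, hf, pow_succ', mul_assoc] at h
  refine Polynomial.prime_X.pow_dvd_of_dvd_mul_left a (fun hdvd => hF2 ?_)
    ((mul_dvd_mul_iff_left Polynomial.X_ne_zero).1 h)
  rw [hf, pow_two]
  exact mul_dvd_mul_left _ hdvd

theorem homogeneousComponent_mem_pointsSymbolicPower {K : Type*} [Field K] {N : ℕ}
    {S : Finset (ℙ K (Fin (N + 1) → K))} {m : ℕ} {F : MvPolynomial (Fin (N + 1)) K}
    (hF : F ∈ pointsSymbolicPower S m) (d : ℕ) :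
    MvPolynomial.homogeneousComponent d F ∈ pointsSymbolicPower S m := by
  let := MvPolynomial.gradedAlgebra (R := K) (σ := Fin (N + 1))
  refine MvPolynomial.homogeneousComponent_mem_of_mem ?_ hF d
  refine Ideal.IsHomogeneous.iInf₂ fun P _ => ?_
  have h1 : (pointIdeal P).IsHomogeneous
      (MvPolynomial.homogeneousSubmodule (Fin (N + 1)) K) := by
    refine Ideal.homogeneous_span _ _ ?_
    rintro G ⟨⟨e, he⟩, -⟩
    exact ⟨e, he⟩
  induction m with
  | zero => rw [pow_zero, Ideal.one_eq_top]; exact Ideal.IsHomogeneous.top _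
  | succ m ih =>
    rw [pow_succ]
    exact Ideal.IsHomogeneous.mul (ih (Ideal.mem_iInf.2 fun Q => Ideal.mem_iInf.2 fun hQ =>
      Ideal.pow_le_pow_right m.le_succ (Ideal.mem_iInf.1 (Ideal.mem_iInf.1 hF Q) hQ))) h1

theorem mem_irrelevantIdeal_pow {K : Type*} [Field K] {N : ℕ}
    {F : MvPolynomial (Fin (N + 1)) K} {d r : ℕ} (hF : F.IsHomogeneous d) (hr : r ≤ d) :
    F ∈ irrelevantIdeal K N ^ r := by
  refine (MvPolynomial.mem_pow_idealOfVars_iff r F).2 fun x hx => ?_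
  rw [hF.degree_eq_sum_deg_support hx] at hr
  exact hr

theorem pointIdeal_le_irrelevantIdeal {K : Type*} [Field K] {N : ℕ}
    (P : ℙ K (Fin (N + 1) → K)) : pointIdeal P ≤ irrelevantIdeal K N := by
  refine Ideal.span_le.2 ?_
  rintro G ⟨⟨d, hd⟩, hG⟩
  rcases Nat.eq_zero_or_pos d with rfl | hpos
  · obtain ⟨c, rfl⟩ : ∃ c, G = MvPolynomial.C c :=
      ⟨_, MvPolynomial.totalDegree_eq_zero_iff_eq_C.1
        ((MvPolynomial.totalDegree_zero_iff_isHomogeneous _).2 hd)⟩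
    have : c = 0 := by simpa [VanishesAt] using hG
    simp [this]
  · have := mem_irrelevantIdeal_pow hd hpos
    rwa [Nat.succ_eq_add_one, zero_add, pow_one] at this

/-! ### Parametrizing a smooth conic -/

/-- The polar form of a ternary quadratic form, given by its Hessian matrix. -/
theorem exists_polarForm {K : Type*} [Field K] {C : MvPolynomial (Fin 3) K}
    (hC : C.IsHomogeneous 2) :
    ∃ B : LinearMap.BilinForm K (Fin 3 → K), (∀ v w, B v w = B w v) ∧
      (∀ v, 2 * MvPolynomial.eval v C = B v v) ∧
      ∀ v i, MvPolynomial.eval v (MvPolynomial.pderiv i C) = B v (Pi.single i 1) := by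
  let H : Matrix (Fin 3) (Fin 3) K := Matrix.of fun j i =>
    MvPolynomial.coeff 0 (MvPolynomial.pderiv j (MvPolynomial.pderiv i C))
  have hH : ∀ i j, MvPolynomial.pderiv j (MvPolynomial.pderiv i C) = MvPolynomial.C (H j i) := by
    intro i j
    have h0 : (MvPolynomial.pderiv j (MvPolynomial.pderiv i C)).IsHomogeneous 0 :=
      (hC.pderiv (i := i)).pderiv
    exact MvPolynomial.totalDegree_eq_zero_iff_eq_C.1
      ((MvPolynomial.totalDegree_zero_iff_isHomogeneous _).2 h0)
  have hsymm : ∀ i j, H i j = H j i := fun i j => by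
    have h0 : ⁅MvPolynomial.pderiv (R := K) i, MvPolynomial.pderiv j⁆ = 0 :=
      MvPolynomial.derivation_ext fun k => by
        rw [Derivation.commutator_apply]
        simp [MvPolynomial.pderiv_X, Pi.single_apply, apply_ite]
    have := congrArg (fun D => D C) h0
    rw [Derivation.commutator_apply, hH, hH, Derivation.zero_apply, sub_eq_zero] at this
    exact MvPolynomial.C_injective _ _ this
  have h1 : ∀ v i, MvPolynomial.eval v (MvPolynomial.pderiv i C) = ∑ j, v j * H j i := by
    intro v i
    have := congrArg (MvPolynomial.eval v) (hC.pderiv (i := i)).sum_X_mul_pderiv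
    simp only [hH, map_sum, map_mul, MvPolynomial.eval_X, MvPolynomial.eval_C] at this
    rw [this]
    simp
  have h2 : ∀ v, 2 * MvPolynomial.eval v C = ∑ i, v i * ∑ j, v j * H j i := by
    intro v
    have := congrArg (MvPolynomial.eval v) hC.sum_X_mul_pderiv
    simp only [h1, map_sum, map_mul, MvPolynomial.eval_X] at this
    rw [this]
    simp
  refine ⟨Matrix.toBilin' H, fun v w => ?_, fun v => ?_, fun v i => ?_⟩
  · simp only [Matrix.toBilin'_apply, Fin.sum_univ_three, hsymm 1 0, hsymm 2 0, hsymm 2 1]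
    ring
  · rw [h2, Matrix.toBilin'_apply]
    simp only [Fin.sum_univ_three, hsymm 1 0, hsymm 2 0, hsymm 2 1]
    ring
  · rw [h1, Matrix.toBilin'_apply]
    simp [Pi.single_apply]

theorem eval_smul_of_isHomogeneous {K σ : Type*} [Field K] {F : MvPolynomial σ K} {d : ℕ}
    (hF : F.IsHomogeneous d) (c : K) (v : σ → K) :
    MvPolynomial.eval (c • v) F = c ^ d * MvPolynomial.eval v F := by
  rw [F.as_sum, map_sum, map_sum, Finset.mul_sum]
  refine Finset.sum_congr rfl fun s hs => ?_
  rw [MvPolynomial.eval_monomial, MvPolynomial.eval_monomial, Finsupp.prod, Finsupp.prod,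
    hF.degree_eq_sum_deg_support hs, ← Finset.prod_pow_eq_pow_sum, mul_left_comm,
    ← Finset.prod_mul_distrib]
  simp only [Pi.smul_apply, smul_eq_mul, mul_pow]

/-- Coordinates in which a smooth conic is `y₁² = y₀ y₂`, with a given point of the conic as the
last basis vector. The first basis vector is a second point of the conic, and the middle one is
the intersection of the tangents at these two points. -/
theorem exists_conic_frame {K : Type*} [Field K] [IsAlgClosed K] [CharZero K]
    {C : MvPolynomial (Fin 3) K} (hC : IsSmoothConic C) (u : Fin 3 → K) (hu : u ≠ 0)
    (hCu : MvPolynomial.eval u C = 0) :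
    ∃ (v : Fin 3 → Fin 3 → K) (κ : K), LinearIndependent K v ∧ v 2 = u ∧ κ ≠ 0 ∧
      ∀ a : Fin 3 → K,
        MvPolynomial.eval (∑ j, a j • v j) C = κ * (a 1 ^ 2 - a 0 * a 2) := by
  obtain ⟨B, hsymm, hdiag, hgrad⟩ := exists_polarForm hC.1
  have hne : (2 : K) ≠ 0 := two_ne_zero
  -- Smoothness: no isotropic vector lies in the radical of the polar form.
  have hnd : ∀ w : Fin 3 → K, w ≠ 0 → B w w = 0 → ∃ x, B w x ≠ 0 := by
    intro w hw hww
    obtain ⟨c, hc⟩ := Projectivization.exists_smul_eq_mk_rep K w hw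
    have hc' : (Projectivization.mk K w hw).rep = (c : K) • w := hc.symm
    have hvan : VanishesAt C (Projectivization.mk K w hw) := by
      refine (mul_eq_zero.1 ?_).resolve_left hne
      rw [hdiag, hc']
      simp [hww]
    obtain ⟨i, hi⟩ := hC.2 _ hvan
    refine ⟨Pi.single i 1, fun h => hi ?_⟩
    rw [VanishesAt, hgrad, hc']
    simp [h]
  have huu : B u u = 0 := by rw [← hdiag, hCu, mul_zero]
  obtain ⟨w, hw⟩ := hnd u hu huu
  -- the second intersection point with the conic of the line through `u` and `w`
  obtain ⟨v₀, hv₀, h₀⟩ : ∃ v₀, B v₀ v₀ = 0 ∧ B u v₀ ≠ 0 := by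
    refine ⟨w - (B w w / (2 * B u w)) • u, ?_, ?_⟩
    · simp only [map_sub, map_smul, LinearMap.sub_apply, LinearMap.smul_apply, smul_eq_mul, huu,
        hsymm w u]
      field_simp
      ring
    · simpa [huu] using hw
  obtain ⟨x, hx, hxne⟩ : ∃ x ∈ LinearMap.ker ((B u).prod (B v₀)), x ≠ 0 := by
    refine Submodule.exists_mem_ne_zero_of_ne_bot (LinearMap.ker_ne_bot_of_finrank_lt ?_)
    simp
  obtain ⟨hux, hvx⟩ : B u x = 0 ∧ B v₀ x = 0 := by simpa using hx
  have hli : ∀ y : Fin 3 → K, y ≠ 0 → B u y = 0 → B v₀ y = 0 →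
      LinearIndependent K ![v₀, y, u] := by
    intro y hy huy hvy
    rw [Fintype.linearIndependent_iff]
    intro g hg
    simp only [Fin.sum_univ_three, Matrix.cons_val_zero, Matrix.cons_val_one, Matrix.cons_val]
      at hg
    have hg0 : g 0 = 0 := by
      have := congrArg (B u) hg
      simpa [huy, huu, h₀] using this
    have hg2 : g 2 = 0 := by
      have := congrArg (B v₀) hg
      simpa [hvy, hv₀, hsymm v₀ u, h₀] using this
    have hg1 : g 1 = 0 := by simpa [hg0, hg2, hy] using hg
    intro i
    fin_cases i <;> assumption
  -- Otherwise `x` would be a point of the conic in the radical of `B`, hence singular.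
  have hxx : B x x ≠ 0 := by
    intro h
    obtain ⟨y, hy⟩ := hnd x hxne h
    have hspan := (hli x hxne hux hvx).span_eq_top_of_card_eq_finrank (by simp)
    have hle : Submodule.span K (Set.range ![v₀, x, u]) ≤ LinearMap.ker (B x) := by
      rw [Submodule.span_le, Set.range_subset_iff]
      intro i
      fin_cases i <;> simp [h, hsymm x, hux, hvx]
    rw [hspan] at hle
    exact hy (hle Submodule.mem_top)
  -- The middle vector is scaled so that the cross terms `y₁²` and `y₀ y₂` cancel on `y₁² = y₀ y₂`.
  obtain ⟨c, hc⟩ := IsAlgClosed.exists_pow_nat_eq (-(2 * B u v₀) / B x x) (n := 2) two_pos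
  have hcne : c ≠ 0 := by
    rintro rfl
    rw [zero_pow two_ne_zero, eq_comm, div_eq_zero_iff] at hc
    simp_all
  refine ⟨![v₀, c • x, u], -B u v₀, hli _ (smul_ne_zero hcne hxne) (by simp [hux])
    (by simp [hvx]), rfl, neg_ne_zero.2 h₀, fun a => ?_⟩
  refine mul_left_cancel₀ hne ?_
  have hcx : c ^ 2 * B x x = -(2 * B u v₀) := by rw [hc]; field_simp
  rw [hdiag]
  simp only [Fin.sum_univ_three, Matrix.cons_val_zero, Matrix.cons_val_one, Matrix.cons_val,
    map_add, map_smul, LinearMap.add_apply, LinearMap.smul_apply, smul_eq_mul, huu, hv₀, hux, hvx,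
    hsymm x u, hsymm x v₀, hsymm v₀ u]
  linear_combination a 1 ^ 2 * hcx

/-- As the conic has infinitely many points, the one taken as last basis vector can be chosen
outside a given finite set. -/
theorem exists_conic_frame_avoiding {K : Type*} [Field K] [IsAlgClosed K] [CharZero K]
    {C : MvPolynomial (Fin 3) K} (hC : IsSmoothConic C) (S : Finset (ℙ K (Fin 3 → K)))
    (hne : S.Nonempty) (hS : ∀ P ∈ S, VanishesAt C P) :
    ∃ (v : Fin 3 → Fin 3 → K) (κ : K), LinearIndependent K v ∧ κ ≠ 0 ∧
      (∀ a : Fin 3 → K,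
        MvPolynomial.eval (∑ j, a j • v j) C = κ * (a 1 ^ 2 - a 0 * a 2)) ∧
      ∀ P ∈ S, ∀ c : K, P.rep ≠ c • v 2 := by
  obtain ⟨P₀, hP₀⟩ := hne
  obtain ⟨v, κ, hv, -, hκ, hvC⟩ :=
    exists_conic_frame hC P₀.rep P₀.rep_nonzero (hS P₀ hP₀)
  let γ : K → Fin 3 → K := fun z => ∑ j : Fin 3, z ^ (j : ℕ) • v j
  have hγ : ∀ z, γ z ≠ 0 := fun z hz => by
    have := Fintype.linearIndependent_iff.1 hv _ hz 0
    simp at this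
  have hinj : Function.Injective fun z => Projectivization.mk K (γ z) (hγ z) := by
    intro z w hzw
    obtain ⟨c, hc⟩ := (Projectivization.mk_eq_mk_iff' K _ _ (hγ z) (hγ w)).1 hzw
    have h0 : ∑ j : Fin 3, (c * w ^ (j : ℕ) - z ^ (j : ℕ)) • v j = 0 := by
      simp only [sub_smul, Finset.sum_sub_distrib, mul_smul, ← Finset.smul_sum]
      exact sub_eq_zero.2 hc
    have h1 := Fintype.linearIndependent_iff.1 hv _ h0
    have hc1 : c = 1 := by simpa [sub_eq_zero] using h1 0
    have := h1 1
    simp only [hc1, Fin.coe_ofNat_eq_mod, Nat.one_mod, pow_one, one_mul] at this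
    exact (sub_eq_zero.1 this).symm
  obtain ⟨z, hz⟩ := Infinite.exists_notMem_finset (S.preimage _ hinj.injOn)
  rw [Finset.mem_preimage] at hz
  obtain ⟨v', κ', hv', hv2, hκ', hvC'⟩ := exists_conic_frame hC (γ z) (hγ z) (by
    rw [hvC]
    simp)
  refine ⟨v', κ', hv', hκ', hvC', fun P hP c hc => hz ?_⟩
  have : Projectivization.mk K (γ z) (hγ z) = P := by
    rw [← P.mk_rep, Projectivization.mk_eq_mk_iff']
    have hc0 : c ≠ 0 := by
      rintro rfl
      exact P.rep_nonzero (by rw [hc, zero_smul])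
    exact ⟨c⁻¹, by rw [hc, hv2, smul_smul, inv_mul_cancel₀ hc0, one_smul]⟩
  rwa [this]

/-- A rational parametrization of the conic `C = 0` in which no point of the finite set `S` is at
infinity. In the coordinates `form`, the conic is `y₁² = y₀ y₂` and the parametrization is
`z ↦ (1, z, z²)`; restriction of polynomials to the conic is recorded as the homomorphism `toPoly`,
and `param P` is the parameter of the point `P`. -/
structure ConicParam {K : Type*} [Field K] (C : MvPolynomial (Fin 3) K)
    (S : Finset (ℙ K (Fin 3 → K))) where
  toPoly : MvPolynomial (Fin 3) K →ₐ[K] Polynomial K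
  form : Fin 3 → MvPolynomial (Fin 3) K
  const : K
  param : ℙ K (Fin 3 → K) → K
  const_ne_zero : const ≠ 0
  eq_form : C = MvPolynomial.C const * (form 1 ^ 2 - form 0 * form 2)
  form_isHomogeneous : ∀ j, (form j).IsHomogeneous 1
  exists_X_eq : ∃ M : Fin 3 → Fin 3 → K,
    ∀ i, MvPolynomial.X i = ∑ j, MvPolynomial.C (M i j) * form j
  toPoly_form : ∀ j, toPoly (form j) = Polynomial.X ^ (j : ℕ)
  vanishesAt_iff : ∀ P ∈ S, ∀ (F : MvPolynomial (Fin 3) K) (d : ℕ), F.IsHomogeneous d →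
    (VanishesAt F P ↔ (toPoly F).eval (param P) = 0)
  param_injOn : Set.InjOn param S

theorem nonempty_conicParam {K : Type*} [Field K] [IsAlgClosed K] [CharZero K]
    {C : MvPolynomial (Fin 3) K} (hC : IsSmoothConic C) (S : Finset (ℙ K (Fin 3 → K)))
    (hne : S.Nonempty) (hS : ∀ P ∈ S, VanishesAt C P) : Nonempty (ConicParam C S) := by
  obtain ⟨v, κ, hv, hκ, hvC, hvS⟩ := exists_conic_frame_avoiding hC S hne hS
  let b : Module.Basis (Fin 3) K (Fin 3 → K) :=
    basisOfLinearIndependentOfCardEqFinrank hv (by simp)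
  have hb : ⇑b = v := coe_basisOfLinearIndependentOfCardEqFinrank _ _
  let γ : K → Fin 3 → K := fun z => ∑ j : Fin 3, z ^ (j : ℕ) • v j
  let f : Fin 3 → MvPolynomial (Fin 3) K := fun j =>
    ∑ i, MvPolynomial.C (b.coord j (Pi.single i 1)) * MvPolynomial.X i
  have hf : ∀ j w, MvPolynomial.eval w (f j) = b.coord j w := by
    intro j w
    conv_rhs => rw [pi_eq_sum_univ' w]
    simp [f, mul_comm]
  have hsum : ∀ w : Fin 3 → K, ∑ j, b.coord j w • v j = w := by
    intro w
    rw [← hb]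
    exact b.sum_repr w
  have hcoord : ∀ j z, b.coord j (γ z) = z ^ (j : ℕ) := by
    intro j z
    simp only [γ, ← hb]
    rw [Module.Basis.coord_apply, Module.Basis.repr_sum_self]
  let T : MvPolynomial (Fin 3) K →ₐ[K] Polynomial K :=
    MvPolynomial.aeval fun i => ∑ j, Polynomial.C (v j i) * Polynomial.X ^ (j : ℕ)
  have hT : ∀ F z, (T F).eval z = MvPolynomial.eval (γ z) F := by
    intro F z
    have : (Polynomial.evalRingHom z).comp T.toRingHom = MvPolynomial.eval (γ z) := by
      refine MvPolynomial.ringHom_ext (fun r => ?_) fun i => ?_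
      · simp [T]
      · change (T (MvPolynomial.X i)).eval z = MvPolynomial.eval (γ z) (MvPolynomial.X i)
        rw [MvPolynomial.aeval_X, MvPolynomial.eval_X, Polynomial.eval_finsetSum]
        change _ = (∑ j : Fin 3, z ^ (j : ℕ) • v j) i
        rw [Finset.sum_apply]
        refine Finset.sum_congr rfl fun j _ => ?_
        rw [Polynomial.eval_mul, Polynomial.eval_C, Polynomial.eval_pow, Polynomial.eval_X,
          Pi.smul_apply, smul_eq_mul, mul_comm]
    exact congrArg (fun g => g F) this
  have hrep : ∀ P ∈ S, b.coord 0 P.rep ≠ 0 ∧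
      P.rep = b.coord 0 P.rep • γ (b.coord 1 P.rep / b.coord 0 P.rep) := by
    intro P hP
    have h0 := hS P hP
    have hsum' := hsum P.rep
    rw [VanishesAt, ← hsum', hvC, mul_eq_zero, or_iff_right hκ, sub_eq_zero] at h0
    have hne0 : b.coord 0 P.rep ≠ 0 := by
      intro h
      rw [h, zero_mul, sq_eq_zero_iff] at h0
      refine hvS P hP (b.coord 2 P.rep) ?_
      conv_lhs => rw [← hsum']
      rw [Fin.sum_univ_three, h, h0, zero_smul, zero_smul, zero_add, zero_add]
    refine ⟨hne0, ?_⟩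
    conv_lhs => rw [← hsum']
    simp only [γ, Finset.smul_sum, smul_smul]
    refine Finset.sum_congr rfl fun j _ => ?_
    congr 1
    fin_cases j
    · simp
    · simp only [Fin.mk_one, pow_one]
      field_simp
    · simp only [Fin.reduceFinMk, div_pow, h0]
      field_simp
  refine ⟨⟨T, f, κ, fun P => b.coord 1 P.rep / b.coord 0 P.rep, hκ, ?_, ?_,
    ⟨fun i j => v j i, ?_⟩, ?_, ?_, ?_⟩⟩
  · refine MvPolynomial.funext fun w => ?_
    conv_lhs => rw [← hsum w, hvC]
    simp [hf]
  · intro j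
    exact MvPolynomial.IsHomogeneous.sum _ _ _ fun i _ => MvPolynomial.isHomogeneous_C_mul_X _ _
  · intro i
    refine MvPolynomial.funext fun w => ?_
    simp only [MvPolynomial.eval_X, map_sum, map_mul, MvPolynomial.eval_C, hf]
    conv_lhs => rw [← hsum w]
    simp [mul_comm]
  · intro j
    refine Polynomial.funext fun z => ?_
    rw [hT, hf, hcoord, Polynomial.eval_pow, Polynomial.eval_X]
  · intro P hP F d hF
    obtain ⟨h0, h1⟩ := hrep P hP
    rw [hT, VanishesAt, h1, eval_smul_of_isHomogeneous hF, mul_eq_zero,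
      or_iff_right (pow_ne_zero _ h0), ← h1]
  · intro P hP Q hQ hPQ
    obtain ⟨hP0, hP1⟩ := hrep P hP
    obtain ⟨hQ0, hQ1⟩ := hrep Q hQ
    dsimp only at hPQ
    rw [← P.mk_rep, ← Q.mk_rep, Projectivization.mk_eq_mk_iff']
    refine ⟨b.coord 0 P.rep / b.coord 0 Q.rep, ?_⟩
    refine (congrArg _ hQ1).trans ?_
    rw [smul_smul, div_mul_cancel₀ _ hQ0, ← hPQ, ← hP1]

/-! ### Restriction of forms to the conic -/

namespace ConicParam

theorem exists_aeval_form_eq {K : Type*} [Field K] {C : MvPolynomial (Fin 3) K}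
    {S : Finset (ℙ K (Fin 3 → K))} (π : ConicParam C S) {F : MvPolynomial (Fin 3) K} {d : ℕ}
    (hF : F.IsHomogeneous d) :
    ∃ G : MvPolynomial (Fin 3) K, G.IsHomogeneous d ∧ MvPolynomial.aeval π.form G = F := by
  obtain ⟨M, hM⟩ := π.exists_X_eq
  refine ⟨MvPolynomial.aeval (fun i => ∑ j, MvPolynomial.C (M i j) * MvPolynomial.X j) F, ?_, ?_⟩
  · have := hF.aeval (fun i => ∑ j, MvPolynomial.C (M i j) * MvPolynomial.X j) (n := 1)
      fun i => MvPolynomial.IsHomogeneous.sum _ _ _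
        fun j _ => MvPolynomial.isHomogeneous_C_mul_X (M i j) j
    rwa [one_mul] at this
  · have : (MvPolynomial.aeval π.form).comp (MvPolynomial.aeval
        (fun i => ∑ j, MvPolynomial.C (M i j) * MvPolynomial.X j)) =
        AlgHom.id K (MvPolynomial (Fin 3) K) := by
      refine MvPolynomial.algHom_ext fun i => ?_
      conv_rhs => rw [AlgHom.id_apply, hM]
      simp [MvPolynomial.algebraMap_eq]
    exact DFunLike.congr_fun this F

/-- A form of degree `d` is a combination of monomials of degree `d` in the adapted coordinates. -/
theorem eq_sum_monomial {K : Type*} [Field K] {C : MvPolynomial (Fin 3) K}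
    {S : Finset (ℙ K (Fin 3 → K))} (π : ConicParam C S) {F : MvPolynomial (Fin 3) K} {d : ℕ}
    (hF : F.IsHomogeneous d) :
    ∃ (s : Finset (Fin 3 →₀ ℕ)) (c : (Fin 3 →₀ ℕ) → K), (∀ x ∈ s, x 0 + x 1 + x 2 = d) ∧
      F = ∑ x ∈ s, c x • (π.form 0 ^ x 0 * π.form 1 ^ x 1 * π.form 2 ^ x 2) := by
  obtain ⟨G, hG, rfl⟩ := π.exists_aeval_form_eq hF
  refine ⟨G.support, fun x => G.coeff x, fun x hx => ?_, ?_⟩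
  · have h := hG (MvPolynomial.mem_support_iff.1 hx)
    rw [← h, Finsupp.weight_apply, Finsupp.sum_fintype _ _ (by simp)]
    simp [Fin.sum_univ_three]
  · conv_lhs => rw [G.as_sum, map_sum]
    refine Finset.sum_congr rfl fun x _ => ?_
    rw [MvPolynomial.aeval_monomial, Finsupp.prod_fintype _ _ (by simp), Fin.prod_univ_three,
      Algebra.smul_def]

theorem toPoly_monomial {K : Type*} [Field K] {C : MvPolynomial (Fin 3) K}
    {S : Finset (ℙ K (Fin 3 → K))} (π : ConicParam C S) (i j k : ℕ) :
    π.toPoly (π.form 0 ^ i * π.form 1 ^ j * π.form 2 ^ k) = Polynomial.X ^ (j + 2 * k) := by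
  simp only [map_mul, map_pow, π.toPoly_form, Fin.coe_ofNat_eq_mod]
  ring

theorem natDegree_toPoly_le {K : Type*} [Field K] {C : MvPolynomial (Fin 3) K}
    {S : Finset (ℙ K (Fin 3 → K))} (π : ConicParam C S) {F : MvPolynomial (Fin 3) K} {d : ℕ}
    (hF : F.IsHomogeneous d) : (π.toPoly F).natDegree ≤ 2 * d := by
  obtain ⟨s, c, hs, rfl⟩ := π.eq_sum_monomial hF
  rw [map_sum]
  refine Polynomial.natDegree_sum_le_of_forall_le _ _ fun x hx => ?_
  rw [map_smul, toPoly_monomial]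
  refine (Polynomial.natDegree_smul_le _ _).trans ?_
  rw [Polynomial.natDegree_X_pow]
  have := hs x hx
  omega

theorem monomial_isHomogeneous {K : Type*} [Field K] {C : MvPolynomial (Fin 3) K}
    {S : Finset (ℙ K (Fin 3 → K))} (π : ConicParam C S) (i j k : ℕ) :
    (π.form 0 ^ i * π.form 1 ^ j * π.form 2 ^ k).IsHomogeneous (i + j + k) := by
  have h : ∀ l (r : ℕ), (π.form l ^ r).IsHomogeneous r := fun l r => by
    have := (π.form_isHomogeneous l).pow r
    rwa [one_mul] at this
  exact ((h 0 i).mul (h 1 j)).mul (h 2 k)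

/-- Modulo the conic, a monomial of degree `d` in the adapted coordinates depends only on its
restriction to the conic: the exponent of the middle coordinate reduces to its parity. -/
theorem monomial_sub_mem {K : Type*} [Field K] {C : MvPolynomial (Fin 3) K}
    {S : Finset (ℙ K (Fin 3 → K))} (π : ConicParam C S) (d j : ℕ) :
    ∀ i k : ℕ, i + j + k = d →
      π.form 0 ^ i * π.form 1 ^ j * π.form 2 ^ k -
        π.form 0 ^ (d - (j + 2 * k) / 2 - (j + 2 * k) % 2) * π.form 1 ^ ((j + 2 * k) % 2) *
          π.form 2 ^ ((j + 2 * k) / 2) ∈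
      (MvPolynomial.homogeneousSubmodule (Fin 3) K (d - 2)).map (LinearMap.mulLeft K C) := by
  induction j using Nat.strong_induction_on with
  | _ j ih =>
    intro i k hd
    rcases lt_or_ge j 2 with hj | hj
    · have h1 : (j + 2 * k) / 2 = k := by omega
      have h2 : (j + 2 * k) % 2 = j := by omega
      have h3 : d - k - j = i := by omega
      rw [h1, h2, h3, sub_self]
      exact zero_mem _
    · obtain ⟨j, rfl⟩ := Nat.exists_eq_add_of_le' hj
      have h := ih j (by omega) (i + 1) (k + 1) (by omega)
      rw [show j + 2 * (k + 1) = j + 2 + 2 * k by ring] at h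
      have h2 : π.form 0 ^ i * π.form 1 ^ (j + 2) * π.form 2 ^ k -
          π.form 0 ^ (i + 1) * π.form 1 ^ j * π.form 2 ^ (k + 1) ∈
          (MvPolynomial.homogeneousSubmodule (Fin 3) K (d - 2)).map (LinearMap.mulLeft K C) := by
        refine ⟨MvPolynomial.C π.const⁻¹ *
          (π.form 0 ^ i * π.form 1 ^ j * π.form 2 ^ k), ?_, ?_⟩
        · refine (MvPolynomial.mem_homogeneousSubmodule _ _).2
            (MvPolynomial.IsHomogeneous.C_mul ?_ _)
          rw [show d - 2 = i + j + k by omega]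
          exact π.monomial_isHomogeneous i j k
        · rw [LinearMap.mulLeft_apply]
          have : (MvPolynomial.C π.const * MvPolynomial.C π.const⁻¹ :
              MvPolynomial (Fin 3) K) = 1 := by
            rw [← MvPolynomial.C_mul, mul_inv_cancel₀ π.const_ne_zero, MvPolynomial.C_1]
          linear_combination (MvPolynomial.C π.const⁻¹ *
            (π.form 0 ^ i * π.form 1 ^ j * π.form 2 ^ k)) * π.eq_form +
            (π.form 1 ^ 2 - π.form 0 * π.form 2) *
            (π.form 0 ^ i * π.form 1 ^ j * π.form 2 ^ k) * this
      have := add_mem h2 h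
      rwa [sub_add_sub_cancel] at this

/-- A form that vanishes identically on the conic is a multiple of its equation. -/
theorem exists_eq_mul_of_toPoly_eq_zero {K : Type*} [Field K] {C : MvPolynomial (Fin 3) K}
    {S : Finset (ℙ K (Fin 3 → K))} (π : ConicParam C S) {F : MvPolynomial (Fin 3) K} {d : ℕ}
    (hF : F.IsHomogeneous d) (h0 : π.toPoly F = 0) :
    ∃ G : MvPolynomial (Fin 3) K, G.IsHomogeneous (d - 2) ∧ F = C * G := by
  -- `L` is a linear section, modulo the conic, of the restriction of forms of degree `d`
  let L : Polynomial K →ₗ[K] MvPolynomial (Fin 3) K :=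
    (Polynomial.basisMonomials K).constr K fun k =>
      π.form 0 ^ (d - k / 2 - k % 2) * π.form 1 ^ (k % 2) * π.form 2 ^ (k / 2)
  have hL : ∀ k : ℕ, L (Polynomial.X ^ k) =
      π.form 0 ^ (d - k / 2 - k % 2) * π.form 1 ^ (k % 2) * π.form 2 ^ (k / 2) := by
    intro k
    have := (Polynomial.basisMonomials K).constr_basis K (fun k =>
      π.form 0 ^ (d - k / 2 - k % 2) * π.form 1 ^ (k % 2) * π.form 2 ^ (k / 2)) k
    rw [Polynomial.coe_basisMonomials] at this
    rw [Polynomial.X_pow_eq_monomial]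
    exact this
  have hmem : F - L (π.toPoly F) ∈
      (MvPolynomial.homogeneousSubmodule (Fin 3) K (d - 2)).map (LinearMap.mulLeft K C) := by
    obtain ⟨s, c, hs, rfl⟩ := π.eq_sum_monomial hF
    rw [map_sum, map_sum, ← Finset.sum_sub_distrib]
    refine Submodule.sum_mem _ fun x hx => ?_
    rw [map_smul, map_smul, ← smul_sub, toPoly_monomial, hL]
    exact Submodule.smul_mem _ _ (π.monomial_sub_mem d (x 1) (x 0) (x 2) (hs x hx))
  rw [h0, map_zero, sub_zero] at hmem
  obtain ⟨G, hG, hGF⟩ := hmem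
  exact ⟨G, hG, hGF.symm⟩

/-- The polynomial whose roots are the parameters of the points of `S`. -/
noncomputable def rootsPoly {K : Type*} [Field K] {C : MvPolynomial (Fin 3) K}
    {S : Finset (ℙ K (Fin 3 → K))} (π : ConicParam C S) : Polynomial K :=
  ∏ P ∈ S, (Polynomial.X - Polynomial.C (π.param P))

theorem rootsPoly_monic {K : Type*} [Field K] {C : MvPolynomial (Fin 3) K}
    {S : Finset (ℙ K (Fin 3 → K))} (π : ConicParam C S) : π.rootsPoly.Monic :=
  Polynomial.monic_prod_of_monic _ _ fun _ _ => Polynomial.monic_X_sub_C _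

theorem natDegree_rootsPoly_pow {K : Type*} [Field K] {C : MvPolynomial (Fin 3) K}
    {S : Finset (ℙ K (Fin 3 → K))} (π : ConicParam C S) (a : ℕ) :
    (π.rootsPoly ^ a).natDegree = S.card * a := by
  rw [π.rootsPoly_monic.natDegree_pow, rootsPoly, Polynomial.natDegree_prod_of_monic _ _
    fun _ _ => Polynomial.monic_X_sub_C _]
  simp [mul_comm]

theorem rootsPoly_pow_dvd {K : Type*} [Field K] {C : MvPolynomial (Fin 3) K}
    {S : Finset (ℙ K (Fin 3 → K))} (π : ConicParam C S) {a : ℕ} {F : MvPolynomial (Fin 3) K}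
    (hF : F ∈ pointsSymbolicPower S a) : π.rootsPoly ^ a ∣ π.toPoly F := by
  rw [rootsPoly, ← Finset.prod_pow]
  refine Finset.prod_dvd_of_coprime (fun P hP Q hQ hPQ => ?_) fun P hP => ?_
  · refine IsCoprime.pow (Polynomial.isCoprime_X_sub_C_of_isUnit_sub ?_)
    exact (sub_ne_zero.2 fun h => hPQ (π.param_injOn hP hQ h)).isUnit
  · have h1 : pointIdeal P ≤
        (Ideal.span {Polynomial.X - Polynomial.C (π.param P)}).comap π.toPoly := by
      refine Ideal.span_le.2 ?_
      rintro G ⟨⟨d, hd⟩, hG⟩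
      rw [SetLike.mem_coe, Ideal.mem_comap, Ideal.mem_span_singleton, Polynomial.dvd_iff_isRoot]
      exact (π.vanishesAt_iff P hP G d hd).1 hG
    have h2 := (Ideal.pow_right_mono h1 a).trans (Ideal.le_comap_pow π.toPoly a)
      (Ideal.mem_iInf.1 (Ideal.mem_iInf.1 hF P) hP)
    rwa [Ideal.mem_comap, Ideal.span_singleton_pow, Ideal.mem_span_singleton] at h2

/-- A polynomial of degree at most two is the restriction of a linear form. -/
theorem exists_linear_toPoly_eq {K : Type*} [Field K] {C : MvPolynomial (Fin 3) K}
    {S : Finset (ℙ K (Fin 3 → K))} (π : ConicParam C S) {q : Polynomial K}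
    (hq : q.natDegree ≤ 2) :
    ∃ G : MvPolynomial (Fin 3) K, G.IsHomogeneous 1 ∧ π.toPoly G = q := by
  refine ⟨∑ j : Fin 3, MvPolynomial.C (q.coeff j) * π.form j,
    MvPolynomial.IsHomogeneous.sum _ _ _ fun j _ => (π.form_isHomogeneous j).C_mul _, ?_⟩
  conv_rhs => rw [q.as_sum_range_C_mul_X_pow' (Nat.lt_succ_of_le hq), Finset.sum_range]
  rw [map_sum]
  refine Finset.sum_congr rfl fun j _ => ?_
  rw [map_mul, π.toPoly_form, ← MvPolynomial.algebraMap_eq, AlgHom.commutes,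
    Polynomial.algebraMap_eq]

end ConicParam

theorem exists_eq_C_mul_prod_of_natDegree_le {K : Type*} [Field K] [IsAlgClosed K] (N : ℕ) :
    ∀ g : Polynomial K, g.natDegree ≤ N → ∃ (c : K) (q : ℕ → Polynomial K),
      (∀ i, (q i).natDegree ≤ 1) ∧ g = Polynomial.C c * ∏ i ∈ Finset.range N, q i := by
  induction N with
  | zero =>
    intro g hg
    refine ⟨g.coeff 0, fun _ => 1, fun _ => by simp, ?_⟩
    simpa using Polynomial.eq_C_of_natDegree_le_zero hg
  | succ N ih =>
    intro g hg
    -- extending the sequence by a constant or by a linear factor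
    have hext : ∀ f r : Polynomial K, f.natDegree ≤ N → r.natDegree ≤ 1 → g = f * r →
        ∃ (c : K) (q : ℕ → Polynomial K), (∀ i, (q i).natDegree ≤ 1) ∧
          g = Polynomial.C c * ∏ i ∈ Finset.range (N + 1), q i := by
      intro f r hf hr hg
      obtain ⟨c, q, hq, rfl⟩ := ih f hf
      refine ⟨c, Function.update q N r, fun i => ?_, ?_⟩
      · rcases eq_or_ne i N with rfl | hi
        · rwa [Function.update_self]
        · rw [Function.update_of_ne hi]
          exact hq i
      · rw [hg, Finset.prod_range_succ, Function.update_self, mul_assoc]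
        congr 2
        refine Finset.prod_congr rfl fun i hi => ?_
        rw [Function.update_of_ne (Finset.mem_range.1 hi).ne]
    rcases Nat.lt_or_ge g.natDegree (N + 1) with h | h
    · exact hext g 1 (Nat.lt_succ_iff.1 h) (by simp) (mul_one g).symm
    · obtain ⟨x, hx⟩ := IsAlgClosed.exists_root g (by
        intro h0
        rw [Polynomial.natDegree_eq_zero_iff_degree_le_zero.2 h0.le] at h
        omega)
      obtain ⟨f, hf⟩ := Polynomial.dvd_iff_isRoot.2 hx
      refine hext f (Polynomial.X - Polynomial.C x) ?_ (Polynomial.natDegree_X_sub_C_le x)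
        (by rw [hf, mul_comm])
      have := hf ▸ hg
      rcases eq_or_ne f 0 with rfl | hf0
      · simp
      · rw [Polynomial.natDegree_mul (Polynomial.X_sub_C_ne_zero x) hf0,
          Polynomial.natDegree_X_sub_C] at this
        omega

theorem prod_range_two_mul {M : Type*} [CommMonoid M] (f : ℕ → M) (e : ℕ) :
    ∏ i ∈ Finset.range (2 * e), f i = ∏ i ∈ Finset.range e, f (2 * i) * f (2 * i + 1) := by
  induction e with
  | zero => simp
  | succ e ih => rw [mul_add, mul_one, Finset.prod_range_succ, Finset.prod_range_succ, ih,
      Finset.prod_range_succ, mul_assoc]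

theorem prod_range_mul_of_periodic {M : Type*} [CommMonoid M] {f : ℕ → M} {n : ℕ}
    (hf : Function.Periodic f n) (a : ℕ) :
    ∏ i ∈ Finset.range (n * a), f i = (∏ i ∈ Finset.range n, f i) ^ a := by
  induction a with
  | zero => simp
  | succ a ih =>
    rw [mul_add, mul_one, Finset.prod_range_add, ih, pow_succ]
    congr 1
    refine Finset.prod_congr rfl fun i _ => ?_
    rw [add_comm, mul_comm]
    exact hf.nat_mul a i

/-- Every polynomial that satisfies the evident conditions for being the restriction of a form
of degree `d` in `I^{(a)}` is one. The form is a product of `d` lines: the points of `S` are listed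
cyclically `a` times, followed by the remaining roots, and each line joins two successive entries of
the list. No line of the first `a` rounds meets a point of `S` twice, so each point of `S` lies on
`a` of these lines. -/
theorem ConicParam.exists_toPoly_eq {K : Type*} [Field K] [IsAlgClosed K]
    {C : MvPolynomial (Fin 3) K} {S : Finset (ℙ K (Fin 3 → K))} (π : ConicParam C S)
    (hcard : 2 ≤ S.card) {a d : ℕ} (had : S.card * a ≤ 2 * d) {g : Polynomial K}
    (hg : g.natDegree ≤ 2 * d - S.card * a) :
    ∃ G : MvPolynomial (Fin 3) K, G.IsHomogeneous d ∧ G ∈ pointsSymbolicPower S a ∧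
      π.toPoly G = π.rootsPoly ^ a * g := by
  have hpos : 0 < S.card := by omega
  obtain ⟨c, q, hq, rfl⟩ := exists_eq_C_mul_prod_of_natDegree_le _ g hg
  let w : ℕ → ℙ K (Fin 3 → K) := fun i => S.equivFin.symm ⟨i % S.card, Nat.mod_lt _ hpos⟩
  let l : ℕ → Polynomial K := fun i => Polynomial.X - Polynomial.C (π.param (w i))
  have hw : Function.Periodic l S.card := fun i => by simp [l, w]
  have hroots : ∏ i ∈ Finset.range S.card, l i = π.rootsPoly := by
    rw [Finset.prod_range, rootsPoly]
    refine (Finset.prod_congr rfl fun i _ => ?_).trans ((S.equivFin.symm.prod_comp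
      fun P : S => Polynomial.X - Polynomial.C (π.param P)).trans
        (Finset.prod_coe_sort S fun P => Polynomial.X - Polynomial.C (π.param P)))
    simp [l, w, Nat.mod_eq_of_lt i.2]
  let f : ℕ → Polynomial K := fun i => if i < S.card * a then l i else q (i - S.card * a)
  have hf1 : ∀ i, (f i).natDegree ≤ 1 := by
    intro i
    by_cases hi : i < S.card * a
    · simp only [f, if_pos hi]
      exact Polynomial.natDegree_X_sub_C_le _
    · simp only [f, if_neg hi]
      exact hq _
  have hfprod : ∏ i ∈ Finset.range (2 * d), f i =
      π.rootsPoly ^ a * ∏ i ∈ Finset.range (2 * d - S.card * a), q i := by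
    rw [← hroots, ← prod_range_mul_of_periodic hw]
    conv_lhs => rw [← Nat.add_sub_of_le had, Finset.prod_range_add]
    congr 1
    · exact Finset.prod_congr rfl fun i hi => if_pos (Finset.mem_range.1 hi)
    · refine Finset.prod_congr rfl fun i _ => ?_
      simp [f]
  have hline : ∀ i, ∃ G : MvPolynomial (Fin 3) K,
      G.IsHomogeneous 1 ∧ π.toPoly G = f (2 * i) * f (2 * i + 1) := fun i =>
    π.exists_linear_toPoly_eq (Polynomial.natDegree_mul_le.trans
      (Nat.add_le_add (hf1 (2 * i)) (hf1 (2 * i + 1))))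
  choose line hline1 hlineT using hline
  refine ⟨MvPolynomial.C c * ∏ i ∈ Finset.range d, line i, ?_, ?_, ?_⟩
  · refine MvPolynomial.IsHomogeneous.C_mul ?_ _
    have := MvPolynomial.IsHomogeneous.prod (Finset.range d) line (fun _ => 1)
      fun i _ => hline1 i
    simpa using this
  · refine Ideal.mul_mem_left _ _ (Ideal.mem_iInf.2 fun P => Ideal.mem_iInf.2 fun hP => ?_)
    set r : ℕ := (S.equivFin ⟨P, hP⟩ : ℕ) with hr
    have hrlt : r < S.card := (S.equivFin ⟨P, hP⟩).2
    have hwr : ∀ k, w (r + S.card * k) = P := by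
      intro k
      have h : (⟨(r + S.card * k) % S.card, Nat.mod_lt _ hpos⟩ : Fin S.card) =
          S.equivFin ⟨P, hP⟩ := by
        rw [Fin.ext_iff, Fin.val_mk, Nat.add_mul_mod_self_left, Nat.mod_eq_of_lt hrlt]
      simp only [w, h, Equiv.symm_apply_apply]
    have hbound : ∀ k < a, r + S.card * k < S.card * a := fun k hk => by
      have : S.card * (k + 1) ≤ S.card * a := Nat.mul_le_mul_left _ hk
      rw [mul_add] at this
      omega
    have hinj : Set.InjOn (fun k => (r + S.card * k) / 2) (Finset.range a) := by
      have key : ∀ k k', k < k' → (r + S.card * k) / 2 ≠ (r + S.card * k') / 2 := by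
        intro k k' hk
        have : S.card * (k + 1) ≤ S.card * k' := Nat.mul_le_mul_left _ hk
        rw [mul_add] at this
        omega
      intro k _ k' _ h
      rcases lt_trichotomy k k' with hk | hk | hk
      · exact absurd h (key k k' hk)
      · exact hk
      · exact absurd h.symm (key k' k hk)
    have hmem : ∀ k ∈ Finset.range a, line ((r + S.card * k) / 2) ∈ pointIdeal P := by
      intro k hk
      refine mem_pointIdeal_of_isHomogeneous (hline1 _)
        ((π.vanishesAt_iff P hP _ 1 (hline1 _)).2 ?_)
      have hfx : (f (r + S.card * k)).eval (π.param P) = 0 := by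
        simp only [f, if_pos (hbound k (Finset.mem_range.1 hk)), l, hwr]
        simp
      rw [hlineT, Polynomial.eval_mul]
      rcases Nat.mod_two_eq_zero_or_one (r + S.card * k) with h | h
      · rw [show 2 * ((r + S.card * k) / 2) = r + S.card * k by omega, hfx, zero_mul]
      · rw [show 2 * ((r + S.card * k) / 2) + 1 = r + S.card * k by omega, hfx, mul_zero]
    have hprod : ∏ k ∈ Finset.range a, line ((r + S.card * k) / 2) ∈ pointIdeal P ^ a := by
      have := Ideal.prod_mem_prod hmem
      rwa [Finset.prod_const, Finset.card_range] at this
    refine Ideal.mem_of_dvd _ ?_ hprod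
    rw [← Finset.prod_image hinj]
    refine Finset.prod_dvd_prod_of_subset _ _ _ fun i hi => ?_
    obtain ⟨k, hk, rfl⟩ := Finset.mem_image.1 hi
    have := hbound k (Finset.mem_range.1 hk)
    rw [Finset.mem_range]
    omega
  · rw [map_mul, map_prod, Finset.prod_congr rfl fun i _ => hlineT i, ← prod_range_two_mul, hfprod,
      ← MvPolynomial.algebraMap_eq, AlgHom.commutes, Polynomial.algebraMap_eq]
    ring

/-! ### Products of symbolic powers -/

/-- The forms of degree `d` in the symbolic power `I^{(a)}`. -/
noncomputable def symbolicForms {K : Type*} [Field K] {N : ℕ}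
    (S : Finset (ℙ K (Fin (N + 1) → K))) (a d : ℕ) :
    Submodule K (MvPolynomial (Fin (N + 1)) K) :=
  MvPolynomial.homogeneousSubmodule (Fin (N + 1)) K d ⊓
    (pointsSymbolicPower S a).restrictScalars K

theorem mem_symbolicForms {K : Type*} [Field K] {N : ℕ} {S : Finset (ℙ K (Fin (N + 1) → K))}
    {a d : ℕ} {F : MvPolynomial (Fin (N + 1)) K} :
    F ∈ symbolicForms S a d ↔ F.IsHomogeneous d ∧ F ∈ pointsSymbolicPower S a := Iff.rfl

theorem symbolicForms_zero {K : Type*} [Field K] {N : ℕ} (S : Finset (ℙ K (Fin (N + 1) → K)))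
    (d : ℕ) : symbolicForms S 0 d = MvPolynomial.homogeneousSubmodule (Fin (N + 1)) K d := by
  ext F
  simp [symbolicForms, pointsSymbolicPower]

theorem mem_pointsSymbolicPower {K : Type*} [Field K] {N : ℕ}
    {S : Finset (ℙ K (Fin (N + 1) → K))} {a : ℕ} {F : MvPolynomial (Fin (N + 1)) K} :
    F ∈ pointsSymbolicPower S a ↔ ∀ P ∈ S, F ∈ pointIdeal P ^ a := by
  simp [pointsSymbolicPower]

theorem mul_mem_pointsSymbolicPower {K : Type*} [Field K] {N : ℕ}
    {S : Finset (ℙ K (Fin (N + 1) → K))} {a b : ℕ} {F G : MvPolynomial (Fin (N + 1)) K}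
    (hF : F ∈ pointsSymbolicPower S a) (hG : G ∈ pointsSymbolicPower S b) :
    F * G ∈ pointsSymbolicPower S (a + b) := by
  rw [mem_pointsSymbolicPower] at *
  intro P hP
  rw [pow_add]
  exact Ideal.mul_mem_mul (hF P hP) (hG P hP)

theorem mul_mem_symbolicForms {K : Type*} [Field K] {N : ℕ}
    {S : Finset (ℙ K (Fin (N + 1) → K))} {a b d e : ℕ} {F G : MvPolynomial (Fin (N + 1)) K}
    (hF : F ∈ symbolicForms S a d) (hG : G ∈ symbolicForms S b e) :
    F * G ∈ symbolicForms S (a + b) (d + e) :=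
  ⟨MvPolynomial.IsHomogeneous.mul hF.1 hG.1, mul_mem_pointsSymbolicPower hF.2 hG.2⟩

theorem mem_symbolicForms_one {K : Type*} [Field K] {C : MvPolynomial (Fin 3) K}
    (hC : IsSmoothConic C) {S : Finset (ℙ K (Fin 3 → K))} (hS : ∀ P ∈ S, VanishesAt C P) :
    C ∈ symbolicForms S 1 2 :=
  ⟨hC.1, mem_pointsSymbolicPower.2 fun P hP => by
    rw [pow_one]
    exact mem_pointIdeal_of_isHomogeneous hC.1 (hS P hP)⟩

theorem pow_mem_pointsSymbolicPower {K : Type*} [Field K] {C : MvPolynomial (Fin 3) K}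
    (hC : IsSmoothConic C) {S : Finset (ℙ K (Fin 3 → K))} (hS : ∀ P ∈ S, VanishesAt C P) (a : ℕ) :
    C ^ a ∈ pointsSymbolicPower S a :=
  mem_pointsSymbolicPower.2 fun P hP =>
    Ideal.pow_mem_pow (mem_pointIdeal_of_isHomogeneous hC.1 (hS P hP)) a

/-- A form in `I^{(a+1)}` vanishing identically on the conic is the equation of the conic times
a form in `I^{(a)}`. -/
theorem exists_eq_mul_of_mem_symbolicForms {K : Type*} [Field K] {C : MvPolynomial (Fin 3) K}
    (hC : IsSmoothConic C) {S : Finset (ℙ K (Fin 3 → K))} (hS : ∀ P ∈ S, VanishesAt C P)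
    (π : ConicParam C S) {a d : ℕ} {F : MvPolynomial (Fin 3) K}
    (hF : F ∈ symbolicForms S (a + 1) d) (h0 : π.toPoly F = 0) :
    ∃ G ∈ symbolicForms S a (d - 2), F = C * G := by
  obtain ⟨G, hG, rfl⟩ := π.exists_eq_mul_of_toPoly_eq_zero hF.1 h0
  refine ⟨G, ⟨hG, mem_pointsSymbolicPower.2 fun P hP => ?_⟩, rfl⟩
  refine mem_pointIdeal_pow_of_mul_mem (mem_pointIdeal_of_isHomogeneous hC.1 (hS P hP)) ?_
    (mem_pointsSymbolicPower.1 hF.2 P hP)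
  intro hC2
  obtain ⟨i, hi⟩ := hC.2 P (hS P hP)
  exact hi (eval_pderiv_eq_zero_of_mem_pointIdeal_sq hC2 i)

theorem exists_eq_mul_of_natDegree_le_add {K : Type*} [Field K] [IsAlgClosed K] {A B : ℕ}
    {g : Polynomial K} (hg : g.natDegree ≤ A + B) :
    ∃ g₁ g₂ : Polynomial K, g₁.natDegree ≤ A ∧ g₂.natDegree ≤ B ∧ g = g₁ * g₂ := by
  obtain ⟨c, q, hq, rfl⟩ := exists_eq_C_mul_prod_of_natDegree_le _ g hg
  refine ⟨Polynomial.C c * ∏ i ∈ Finset.range A, q i, ∏ i ∈ Finset.range B, q (A + i), ?_, ?_, ?_⟩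
  · refine (Polynomial.natDegree_C_mul_le _ _).trans ((Polynomial.natDegree_prod_le _ _).trans ?_)
    exact (Finset.sum_le_card_nsmul _ _ 1 fun i _ => hq i).trans (by simp)
  · refine (Polynomial.natDegree_prod_le _ _).trans ?_
    exact (Finset.sum_le_card_nsmul _ _ 1 fun i _ => hq (A + i)).trans (by simp)
  · rw [Finset.prod_range_add, mul_assoc]

/-- Multiplication of symbolic powers is surjective in the degrees in which the conic is not
forced to be a component. On the conic this is the factorization of binary forms; the error is a
multiple of the conic, to which induction applies. -/
theorem symbolicForms_add_le_mul {K : Type*} [Field K] [IsAlgClosed K]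
    {C : MvPolynomial (Fin 3) K} (hC : IsSmoothConic C) {S : Finset (ℙ K (Fin 3 → K))}
    (hS : ∀ P ∈ S, VanishesAt C P) (π : ConicParam C S) (hcard : 4 ≤ S.card) (s : ℕ) :
    ∀ a b d e : ℕ, a + b = s → S.card * a ≤ 2 * d → S.card * b ≤ 2 * e →
      symbolicForms S (a + b) (d + e) ≤ symbolicForms S a d * symbolicForms S b e := by
  induction s with
  | zero =>
    intro a b d e hab _ _
    obtain ⟨rfl, rfl⟩ : a = 0 ∧ b = 0 := by omega
    rw [add_zero, symbolicForms_zero, symbolicForms_zero, symbolicForms_zero,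
      ← MvPolynomial.homogeneousSubmodule_one_pow _ d,
      ← MvPolynomial.homogeneousSubmodule_one_pow _ e,
      ← pow_add, MvPolynomial.homogeneousSubmodule_one_pow]
  | succ s ih =>
    intro a b d e hab had hbe F hF
    have hdvd := π.rootsPoly_pow_dvd hF.2
    obtain ⟨g, hg⟩ := hdvd
    have hdeg : g.natDegree ≤ (2 * d - S.card * a) + (2 * e - S.card * b) := by
      rcases eq_or_ne g 0 with rfl | hg0
      · simp
      · have h := π.natDegree_toPoly_le hF.1
        rw [hg, Polynomial.natDegree_mul (π.rootsPoly_monic.pow _).ne_zero hg0,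
          π.natDegree_rootsPoly_pow, mul_add] at h
        omega
    obtain ⟨g₁, g₂, hg₁, hg₂, rfl⟩ := exists_eq_mul_of_natDegree_le_add hdeg
    obtain ⟨G₁, hG₁, hG₁S, hG₁T⟩ := π.exists_toPoly_eq (by omega) had hg₁
    obtain ⟨G₂, hG₂, hG₂S, hG₂T⟩ := π.exists_toPoly_eq (by omega) hbe hg₂
    have hprod : G₁ * G₂ ∈ symbolicForms S (a + b) (d + e) :=
      mul_mem_symbolicForms ⟨hG₁, hG₁S⟩ ⟨hG₂, hG₂S⟩
    have hD0 : π.toPoly (F - G₁ * G₂) = 0 := by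
      rw [map_sub, map_mul, hg, hG₁T, hG₂T]
      ring
    have hD := sub_mem hF hprod
    rw [hab] at hD
    obtain ⟨G, hG, hDG⟩ := exists_eq_mul_of_mem_symbolicForms hC hS π hD hD0
    have hC1 := mem_symbolicForms_one hC hS
    have hmem : C * G ∈ symbolicForms S a d * symbolicForms S b e := by
      rcases Nat.eq_zero_or_pos a with ha | ha
      · obtain ⟨b, rfl⟩ := Nat.exists_eq_add_of_le' (show 1 ≤ b by omega)
        rw [mul_add, mul_one] at hbe
        obtain ⟨e, rfl⟩ := Nat.exists_eq_add_of_le' (show 2 ≤ e by omega)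
        have h := ih a b d e (by omega) had (by omega)
        rw [show a + b = s by omega] at h
        have hG' := h hG
        refine Submodule.mul_induction_on hG' (fun x hx y hy => ?_) fun x y hx hy => ?_
        · rw [mul_left_comm]
          refine Submodule.mul_mem_mul hx ?_
          rw [add_comm b, add_comm e]
          exact mul_mem_symbolicForms hC1 hy
        · rw [mul_add]
          exact add_mem hx hy
      · obtain ⟨a, rfl⟩ := Nat.exists_eq_add_of_le' (show 1 ≤ a by omega)
        rw [mul_add, mul_one] at had
        obtain ⟨d, rfl⟩ := Nat.exists_eq_add_of_le' (show 2 ≤ d by omega)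
        have h := ih a b d e (by omega) (by omega) hbe
        rw [show a + b = s by omega, show d + e = d + 2 + e - 2 by omega] at h
        have hG' := h hG
        refine Submodule.mul_induction_on hG' (fun x hx y hy => ?_) fun x y hx hy => ?_
        · rw [← mul_assoc]
          refine Submodule.mul_mem_mul ?_ hy
          rw [add_comm a, add_comm d]
          exact mul_mem_symbolicForms hC1 hx
        · rw [mul_add]
          exact add_mem hx hy
    rw [← sub_add_cancel F (G₁ * G₂), hDG]
    exact add_mem hmem (Submodule.mul_mem_mul ⟨hG₁, hG₁S⟩ ⟨hG₂, hG₂S⟩)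

/-! ### Containments -/

/-- By Bézout's theorem, a form in `I^{(b+q)}` of too small a degree is divisible by the conic;
the conic is split off until the degree is large enough, but at most `b` times. -/
theorem exists_eq_pow_mul_of_mem_symbolicForms {K : Type*} [Field K]
    {C : MvPolynomial (Fin 3) K} (hC : IsSmoothConic C) {S : Finset (ℙ K (Fin 3 → K))}
    (hS : ∀ P ∈ S, VanishesAt C P) (π : ConicParam C S) (q b : ℕ) :
    ∀ (d : ℕ) (F : MvPolynomial (Fin 3) K), F ∈ symbolicForms S (b + q) d →
      ∃ (j e : ℕ) (G : MvPolynomial (Fin 3) K), j ≤ b ∧ F = C ^ j * G ∧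
        G ∈ symbolicForms S (b - j + q) e ∧ (j = b ∨ S.card * (b - j + q) ≤ 2 * e) := by
  induction b with
  | zero => exact fun d F hF => ⟨0, d, F, le_rfl, by simp, hF, Or.inl rfl⟩
  | succ b ih =>
    intro d F hF
    rcases le_or_gt (S.card * (b + 1 + q)) (2 * d) with h | h
    · exact ⟨0, d, F, Nat.zero_le _, by simp, hF, Or.inr h⟩
    · have h0 : π.toPoly F = 0 := by
        by_contra hne
        have h1 := Polynomial.natDegree_le_of_dvd (π.rootsPoly_pow_dvd hF.2) hne
        have h2 := π.natDegree_toPoly_le hF.1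
        rw [π.natDegree_rootsPoly_pow] at h1
        omega
      rw [add_right_comm] at hF
      obtain ⟨F', hF', rfl⟩ := exists_eq_mul_of_mem_symbolicForms hC hS π hF h0
      obtain ⟨j, e, G, hj, rfl, hG, hor⟩ := ih _ F' hF'
      refine ⟨j + 1, e, G, by omega, by ring, ?_, ?_⟩
      · rwa [Nat.add_sub_add_right]
      · rw [Nat.add_sub_add_right]
        omega

/-- Multiplication by `C ^ j` puts a form in `I^{(tm-j)}` of large degree into
`M ^ r (I^{(m)}) ^ t`: the `j` copies of `C` are shared out among the `t` factors, at most `m` to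
each. The degree bound leaves room for `t` factors of degrees `⌈n bᵢ / 2⌉` in `I^{(bᵢ)}`, where
the `bᵢ` sum to `t * m - j` and `n` is the number of points, and for a factor of degree `r`. -/
theorem pow_mul_mem_of_mem_symbolicForms {K : Type*} [Field K] [IsAlgClosed K]
    {C : MvPolynomial (Fin 3) K} (hC : IsSmoothConic C) {S : Finset (ℙ K (Fin 3 → K))}
    (hS : ∀ P ∈ S, VanishesAt C P) (π : ConicParam C S) (hcard : 4 ≤ S.card) (m r t : ℕ) :
    ∀ (j e : ℕ) (G : MvPolynomial (Fin 3) K), j ≤ t * m → G ∈ symbolicForms S (t * m - j) e →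
      S.card * (t * m - j) + t + 2 * r ≤ 2 * e →
      C ^ j * G ∈ irrelevantIdeal K 2 ^ r * pointsSymbolicPower S m ^ t := by
  induction t with
  | zero =>
    intro j e G hj hG he
    obtain rfl : j = 0 := by omega
    rw [pow_zero, pow_zero, one_mul, mul_one]
    exact mem_irrelevantIdeal_pow hG.1 (by omega)
  | succ t ih =>
    intro j e G hj hG he
    rw [pow_succ, ← mul_assoc]
    rcases le_or_gt m j with hmj | hmj
    · obtain ⟨j, rfl⟩ := Nat.exists_eq_add_of_le' hmj
      have hsub : (t + 1) * m - (j + m) = t * m - j := by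
        rw [add_mul, one_mul, Nat.add_sub_add_right]
      rw [hsub] at hG he
      rw [add_mul, one_mul] at hj
      rw [pow_add, mul_right_comm (C ^ j)]
      exact Ideal.mul_mem_mul (ih j e G (by omega) hG (by omega))
        (pow_mem_pointsSymbolicPower hC hS m)
    · have hsub : (t + 1) * m - j = t * m + (m - j) := by
        rw [add_mul, one_mul]
        omega
      rw [hsub, mul_add] at he
      rw [hsub] at hG
      obtain ⟨d, hd1, hd2⟩ : ∃ d, S.card * (m - j) ≤ 2 * d ∧ 2 * d ≤ S.card * (m - j) + 1 :=
        ⟨(S.card * (m - j) + 1) / 2, by omega, by omega⟩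
      obtain ⟨e, rfl⟩ := Nat.exists_eq_add_of_le' (show d ≤ e by omega)
      have hmem := symbolicForms_add_le_mul hC hS π hcard _ (t * m) (m - j) e d rfl (by omega) hd1
        hG
      refine Submodule.mul_induction_on hmem (fun x hx y hy => ?_) fun x y hx hy => ?_
      · rw [mul_left_comm]
        refine Ideal.mul_mem_mul ?_ ?_
        · have := ih 0 e x (Nat.zero_le _) hx (by rw [Nat.sub_zero]; omega)
          rwa [pow_zero, one_mul] at this
        · have := mul_mem_pointsSymbolicPower (pow_mem_pointsSymbolicPower hC hS j) hy.2
          rwa [Nat.add_sub_of_le hmj.le] at this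
      · rw [mul_add]
        exact add_mem hx hy

/-- Either `C ^ (t * m)` divides a form in `I^{(tm+q)}`, with a quotient in `I^{(q)} ⊆ M ^ q`, or
what is left after removing the copies of `C` has large degree. The hypothesis `hq` is the room
needed for rounding up `t` degrees to integers and for a factor in `M ^ q`. -/
theorem pointsSymbolicPower_le_of_smoothConic {K : Type*} [Field K] [IsAlgClosed K] [CharZero K]
    {C : MvPolynomial (Fin 3) K} (hC : IsSmoothConic C) {S : Finset (ℙ K (Fin 3 → K))}
    (hS : ∀ P ∈ S, VanishesAt C P) (hcard : 4 ≤ S.card) {m t q : ℕ}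
    (hq : t + 2 * q ≤ S.card * q) :
    pointsSymbolicPower S (t * m + q) ≤
      irrelevantIdeal K 2 ^ q * pointsSymbolicPower S m ^ t := by
  have hne : S.Nonempty := Finset.card_pos.1 (by omega)
  obtain ⟨π⟩ := nonempty_conicParam hC S hne hS
  intro F hF
  rw [← MvPolynomial.sum_homogeneousComponent F]
  refine Ideal.sum_mem _ fun d _ => ?_
  obtain ⟨j, e, G, hj, hFG, hG, hor⟩ := exists_eq_pow_mul_of_mem_symbolicForms hC hS π q (t * m) d _
    ⟨MvPolynomial.homogeneousComponent_isHomogeneous d F,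
      homogeneousComponent_mem_pointsSymbolicPower hF d⟩
  rw [hFG]
  rcases hor with rfl | hor
  · rw [mul_comm t m, pow_mul, mul_comm _ G]
    refine Ideal.mul_mem_mul ?_ (Ideal.pow_mem_pow (pow_mem_pointsSymbolicPower hC hS m) t)
    obtain ⟨P, hP⟩ := hne
    rw [Nat.sub_self, zero_add] at hG
    exact Ideal.pow_right_mono (pointIdeal_le_irrelevantIdeal P) q
      (mem_pointsSymbolicPower.1 hG.2 P hP)
  · rw [mul_add] at hor
    refine pow_mul_mem_of_mem_symbolicForms hC hS π hcard m q t j e G hj ⟨hG.1, ?_⟩ (by omega)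
    exact mem_pointsSymbolicPower.2 fun P hP => Ideal.pow_le_pow_right (Nat.le_add_right _ _)
      (mem_pointsSymbolicPower.1 hG.2 P hP)

theorem mainTheorem1 {K : Type*} [Field K] [IsAlgClosed K] [CharZero K]
    (C : MvPolynomial (Fin 3) K) (hC : IsSmoothConic C)
    (n : ℕ) (hn : 5 ≤ n) (hodd : Odd n)
    (S : Finset (ℙ K (Fin 3 → K))) (hcard : S.card = n)
    (hS : ∀ P ∈ S, VanishesAt C P)
    (m t : ℕ) (hm : 1 ≤ m) (ht : 1 ≤ t) :
    pointsSymbolicPower S (t * (m + 1)) ≤ irrelevantIdeal K 2 ^ t * pointsSymbolicPower S m ^ t ∧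
    pointsSymbolicPower S (t * (m + 1) - 1) ≤ pointsSymbolicPower S m ^ t ∧
    pointsSymbolicPower S (t * (m + 1) - 1) ≤
      irrelevantIdeal K 2 ^ (t - 1) * pointsSymbolicPower S m ^ t := by
  subst hcard
  have h1 : pointsSymbolicPower S (t * (m + 1)) ≤
      irrelevantIdeal K 2 ^ t * pointsSymbolicPower S m ^ t := by
    rw [mul_add, mul_one]
    refine pointsSymbolicPower_le_of_smoothConic hC hS (by omega) ?_
    have : 5 * t ≤ S.card * t := Nat.mul_le_mul_right t hn
    omega
  have h3 : pointsSymbolicPower S (t * (m + 1) - 1) ≤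
      irrelevantIdeal K 2 ^ (t - 1) * pointsSymbolicPower S m ^ t := by
    rcases eq_or_lt_of_le ht with rfl | ht2
    · simp
    · rw [mul_add, mul_one, Nat.add_sub_assoc ht]
      refine pointsSymbolicPower_le_of_smoothConic hC hS (by omega) ?_
      have : 5 * (t - 1) ≤ S.card * (t - 1) := Nat.mul_le_mul_right _ hn
      omega
  exact ⟨h1, h3.trans Ideal.mul_le_right, h3⟩
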